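/- Let $R$ be a commutative ring and let $\mathcal C$ be a poset, regarded as a small category with a unique morphism $c\to d$ if $c\le d$ and none otherwise. An $R\mathcal C$-module is a functor $M\colon\mathcal C\to R\text{-}\mathbf{Mod}$. For $c\in\mathcal C$ let $R[\mathrm{Mor}_{\mathcal C}(c,-)]$ be the $R\mathcal C$-module sending $d$ to the free $R$-module on the set $\mathrm{Mor}_{\mathcal C}(c,d)$. An $R\mathcal C$-module $M$ is called finitely presented if there is an exact sequence of $R\mathcal C$-modules $$\bigoplus_{j\in J}R[\mathrm{Mor}_{\mathcal C}(d_j,-)]\to\bigoplus_{i\in I}R[\mathrm{Mor}_{\mathcal C}(c_i,-)]\to M\to 0$$ with $I$, $J$ finite sets and $c_i,d_j\in\mathcal C$. For $S\subseteq\mathcal C$, $M$ is called $S$-determined if every $c\in\mathcal C$ with $M(c)\neq 0$ satisfies $s\le c$ for some $s\in S$, and for all $c\le d$ in $\mathcal C$ such that $\{s\in S\mid s\le c\}=\{s\in S\mid s\le d\}$ the map $M(c\le d)\colon M(c)\to M(d)$ is an isomorphism. The poset $\mathcal C$ is called weakly bounded from above if every finite subset of $\mathcal C$ has only finitely many minimal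 upper bounds in $\mathcal C$, and mub-complete if for every finite non-empty subset $S\subseteq\mathcal C$ and every upper bound $c$ of $S$ there is a minimal upper bound $s$ of $S$ with $s\le c$. Theorem. Let $M$ be an $R\mathcal C$-module. If $M$ is finitely presented, then 1) $M(c)$ is a finitely presented $R$-module for every $c\in\mathcal C$, and 2) $M$ is $S$-determined for some finite subset $S\subseteq\mathcal C$. Furthermore, if $\mathcal C$ is weakly bounded from above and mub-complete, and $M$ satisfies conditions 1) and 2), then $M$ is finitely presented. -/

import Mathlib

universe u v

noncomputable section

namespace RCMod

open CategoryTheory CategoryTheory.Limits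

section Category

variable (R : Type v) [CommRing R] (C : Type u) [SmallCategory C]

/-- An `RC`-module: a functor from the small category `C` to the category of `R`-modules.
A poset is regarded as a small category with a unique morphism `c ⟶ d` exactly when `c ≤ d`. -/
abbrev RCModule := C ⥤ ModuleCat.{max u v} R

variable {C}

/-- The `RC`-module `R[Mor_C(c, -)]`, sending `d` to the free `R`-module on the set of morphisms
`c ⟶ d` and acting on basis elements by composition. -/
def freeOn (c : C) : RCModule R C where
  obj d := ModuleCat.of R ((c ⟶ d) →₀ R)
  map {_ _} h := ModuleCat.ofHom (Finsupp.lmapDomain R R (fun a => a ≫ h))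
  map_id d := by
    ext : 1
    refine Finsupp.lhom_ext fun a r => ?_
    simp
  map_comp {_ _ _} h k := by
    ext : 1
    refine Finsupp.lhom_ext fun a r => ?_
    simp

variable {R}

/-- `M` is finitely presented: there is an exact sequence of `RC`-modules
`⨁_j R[Mor_C(d_j, -)] ⟶ ⨁_i R[Mor_C(c_i, -)] ⟶ M ⟶ 0` with finitely many `c_i` and `d_j`. -/
def IsFinitelyPresented (M : RCModule R C) : Prop :=
  ∃ (m n : ℕ) (d : Fin m → C) (c : Fin n → C)
    (f : (∐ fun j => freeOn R (d j)) ⟶ (∐ fun i => freeOn R (c i)))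
    (g : (∐ fun i => freeOn R (c i)) ⟶ M) (w : f ≫ g = 0),
    (ShortComplex.mk f g w).Exact ∧ Epi g

end Category

section Poset

variable {R : Type v} [CommRing R] {C : Type u} [PartialOrder C]

/-- The support of `M`: all `c` with `M(c) ≠ 0`. -/
def support (M : RCModule R C) : Set C := {c | Nontrivial (M.obj c)}

/-- `M` is `S`-determined: `supp M` is contained in the upset generated by `S`, and for all
`c ≤ d` with `S ∩ ↓c = S ∩ ↓d` the morphism `M(c ≤ d)` is an isomorphism. -/
def IsDetermined (S : Set C) (M : RCModule R C) : Prop :=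
  support M ⊆ {c | ∃ s ∈ S, s ≤ c} ∧
    ∀ (c d : C) (h : c ≤ d), S ∩ Set.Iic c = S ∩ Set.Iic d → IsIso (M.map (homOfLE h))

/-- The set of minimal upper bounds of `S`. -/
def mub (S : Set C) : Set C := {c | Minimal (fun x => x ∈ upperBounds S) c}

variable (C)

/-- Every finite subset (the empty one included) has only finitely many minimal upper bounds. -/
def WeaklyBoundedFromAbove : Prop := ∀ S : Set C, S.Finite → (mub S).Finite

/-- Every upper bound of a finite non-empty subset lies above a minimal upper bound of it. -/
def MubComplete : Prop :=
  ∀ S : Set C, S.Finite → S.Nonempty → ∀ c ∈ upperBounds S, ∃ s ∈ mub S, s ≤ c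

end Poset

end RCMod

end

noncomputable section

namespace RCMod

open CategoryTheory CategoryTheory.Limits

section Category

variable (R : Type v) [CommRing R] {C : Type u} [SmallCategory C]

/-! Exactness is pointwise, and a finite sum of modules `freeOn R (c i)` is finite free at each
object and determined by the `c i`. Being `S`-determined passes to cokernels and kernels; the
cokernel case gives the forward direction. Conversely, minimal upper bounds of subsets of `S` form a
finite set at which all nonzero values of `M` already occur, so finitely many elements generate `M`
(`exists_epi_of_isDetermined`). The kernel of the resulting epimorphism is again finitely determined
and pointwise finitely generated, so the same argument yields the relations. -/

/-- The basis element of `R[Mor(c, d)]` given by a morphism. -/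
def freeOnBasis {c d : C} (a : c ⟶ d) : (freeOn R c).obj d := Finsupp.single a (1 : R)

/-- The direct sum of the modules `freeOn R (c i)`, described by its basis at each object. -/
def freeFamily {n : ℕ} (c : Fin n → C) : RCModule R C where
  obj d := ModuleCat.of R ((Σ i, (c i ⟶ d)) →₀ R)
  map {_ _} h := ModuleCat.ofHom (Finsupp.lmapDomain R R (fun a => ⟨a.1, a.2 ≫ h⟩))
  map_id d := by
    ext : 1
    refine Finsupp.lhom_ext fun a r => ?_
    simp
  map_comp {_ _ _} h k := by
    ext : 1
    refine Finsupp.lhom_ext fun a r => ?_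
    simp

/-- The basis element of `freeFamily R c` at `d` given by a morphism `c i ⟶ d`. -/
def freeFamilyBasis {n : ℕ} (c : Fin n → C) {d : C} (a : Σ i, (c i ⟶ d)) :
    (freeFamily R c).obj d := Finsupp.single a (1 : R)

variable {R}

theorem freeOn_map_basis {c d e : C} (a : c ⟶ d) (h : d ⟶ e) :
    ((freeOn R c).map h).hom (freeOnBasis R a) = freeOnBasis R (a ≫ h) :=
  Finsupp.mapDomain_single

theorem freeFamily_map_basis {n : ℕ} (c : Fin n → C) {d e : C} (a : Σ i, (c i ⟶ d)) (h : d ⟶ e) :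
    ((freeFamily R c).map h).hom (freeFamilyBasis R c a) =
      freeFamilyBasis R c ⟨a.1, a.2 ≫ h⟩ :=
  Finsupp.mapDomain_single

theorem freeOn_hom_ext {c d : C} {N : ModuleCat R} {f g : (freeOn R c).obj d ⟶ N}
    (h : ∀ a : c ⟶ d, f.hom (freeOnBasis R a) = g.hom (freeOnBasis R a)) : f = g :=
  ModuleCat.hom_ext (Finsupp.lhom_ext' fun a => LinearMap.ext_ring (h a))

theorem freeFamily_hom_ext {n : ℕ} {c : Fin n → C} {d : C} {N : ModuleCat R}
    {f g : (freeFamily R c).obj d ⟶ N}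
    (h : ∀ a, f.hom (freeFamilyBasis R c a) = g.hom (freeFamilyBasis R c a)) : f = g :=
  ModuleCat.hom_ext (Finsupp.lhom_ext' fun a => LinearMap.ext_ring (h a))

/-- The inclusion of a summand into `freeFamily`. -/
def freeFamilyι (R : Type v) [CommRing R] {n : ℕ} (c : Fin n → C) (i : Fin n) :
    freeOn R (c i) ⟶ freeFamily R c where
  app d := ModuleCat.ofHom (Finsupp.lmapDomain R R (fun a => ⟨i, a⟩))
  naturality _ _ h := freeOn_hom_ext fun a => by
    refine (congrArg (Finsupp.lmapDomain R R (Sigma.mk i)) (freeOn_map_basis a h)).trans ?_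
    refine (Finsupp.mapDomain_single (f := Sigma.mk i)).trans ?_
    exact ((congrArg ((freeFamily R c).map h).hom
      (Finsupp.mapDomain_single (f := Sigma.mk i))).trans
      (freeFamily_map_basis c ⟨i, a⟩ h)).symm

theorem freeFamilyι_basis {n : ℕ} (c : Fin n → C) (i : Fin n) {d : C} (a : c i ⟶ d) :
    ((freeFamilyι R c i).app d).hom (freeOnBasis R a) = freeFamilyBasis R c ⟨i, a⟩ :=
  Finsupp.mapDomain_single

theorem naturality_hom {X Y : RCModule R C} (f : X ⟶ Y) {d e : C} (h : d ⟶ e) (x : X.obj d) :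
    (Y.map h).hom ((f.app d).hom x) = (f.app e).hom ((X.map h).hom x) :=
  congr($(f.naturality h).hom x).symm

theorem linearCombination_basis {α N : Type*} [AddCommGroup N] [Module R N] (v : α → N) (a : α) :
    Finsupp.linearCombination R v (Finsupp.single a 1) = v a := by
  rw [Finsupp.linearCombination_single, one_smul]

/-- The morphism out of `freeFamily` given by morphisms out of its summands. -/
def freeFamilyDesc {n : ℕ} {c : Fin n → C} {M : RCModule R C}
    (f : ∀ i, freeOn R (c i) ⟶ M) : freeFamily R c ⟶ M where
  app d := ModuleCat.ofHom (Finsupp.linearCombination R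
    (fun a : Σ i, (c i ⟶ d) => ((f a.1).app d).hom (freeOnBasis R a.2)))
  naturality d e h := freeFamily_hom_ext fun a => by
    refine (congrArg (Finsupp.linearCombination R _) (freeFamily_map_basis c a h)).trans ?_
    refine (linearCombination_basis _ _).trans ?_
    refine Eq.trans ?_ (congrArg (M.map h).hom (linearCombination_basis _ _).symm)
    rw [naturality_hom, freeOn_map_basis]

theorem freeFamilyDesc_basis {n : ℕ} {c : Fin n → C} {M : RCModule R C}
    (f : ∀ i, freeOn R (c i) ⟶ M) {d : C} (a : Σ i, (c i ⟶ d)) :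
    ((freeFamilyDesc f).app d).hom (freeFamilyBasis R c a) =
      ((f a.1).app d).hom (freeOnBasis R a.2) :=
  linearCombination_basis _ _

/-- `freeFamily` is the coproduct of its summands. -/
def freeFamilyIsColimit {n : ℕ} (c : Fin n → C) :
    IsColimit (Cofan.mk (freeFamily R c) (freeFamilyι R c)) :=
  Cofan.IsColimit.mk _ (fun s => freeFamilyDesc s.inj)
    (fun s i => NatTrans.ext <| funext fun d => freeOn_hom_ext fun a =>
      (congrArg _ (freeFamilyι_basis c i a)).trans (freeFamilyDesc_basis _ _))
    (fun s m hm => NatTrans.ext <| funext fun d => freeFamily_hom_ext fun a => by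
      rw [freeFamilyDesc_basis, ← hm]
      exact (congrArg _ (freeFamilyι_basis c a.1 a.2)).symm)

/-- The coproduct of the `freeOn R (c i)` is `freeFamily R c`. -/
def freeFamilyIso {n : ℕ} (c : Fin n → C) : freeFamily R c ≅ ∐ fun i => freeOn R (c i) :=
  (freeFamilyIsColimit c).coconePointUniqueUpToIso (colimit.isColimit _)

/-- The component at `d` of `freeFamilyIso`, as a linear equivalence. -/
def freeFamilyEquiv {n : ℕ} (c : Fin n → C) (d : C) :
    ((Σ i, (c i ⟶ d)) →₀ R) ≃ₗ[R] (∐ fun i => freeOn R (c i) : RCModule R C).obj d :=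
  ((freeFamilyIso c).app d).toLinearEquiv

/-- Transfers the explicit model to the abstract coproduct: transition maps reindex the basis. -/
theorem freeFamilyEquiv_map {n : ℕ} (c : Fin n → C) {d e : C} (h : d ⟶ e)
    (x : (Σ i, (c i ⟶ d)) →₀ R) :
    ((∐ fun i => freeOn R (c i) : RCModule R C).map h).hom (freeFamilyEquiv c d x) =
      freeFamilyEquiv c e (Finsupp.mapDomain (fun a => ⟨a.1, a.2 ≫ h⟩) x) :=
  naturality_hom (freeFamilyIso (R := R) c).hom h x

/-- The morphism `R[Mor(c, -)] ⟶ M` given by an element of `M(c)`. -/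
def freeOnDesc {M : RCModule R C} {c : C} (x : M.obj c) : freeOn R c ⟶ M where
  app d := ModuleCat.ofHom (Finsupp.linearCombination R (fun a : c ⟶ d => (M.map a).hom x))
  naturality d e h := freeOn_hom_ext fun a => by
    refine (congrArg (Finsupp.linearCombination R _) (freeOn_map_basis a h)).trans ?_
    refine (linearCombination_basis _ _).trans ?_
    refine Eq.trans ?_ (congrArg (M.map h).hom (linearCombination_basis _ _).symm)
    rw [M.map_comp, ModuleCat.comp_apply]

theorem freeOnDesc_basis {M : RCModule R C} {c d : C} (x : M.obj c) (a : c ⟶ d) :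
    ((freeOnDesc x).app d).hom (freeOnBasis R a) = (M.map a).hom x :=
  linearCombination_basis _ _

/-- Yoneda, in the form needed for checking that chosen elements generate `M`. -/
theorem exists_hom_of_elements {M : RCModule R C} {n : ℕ} (c : Fin n → C)
    (x : ∀ i, M.obj (c i)) :
    ∃ g : (∐ fun i => freeOn R (c i)) ⟶ M,
      ∀ i d (h : c i ⟶ d), (M.map h).hom (x i) ∈ LinearMap.range (g.app d).hom := by
  refine ⟨Sigma.desc fun i => freeOnDesc (x i), fun i d h => ?_⟩
  refine ⟨((Sigma.ι (fun i => freeOn R (c i)) i).app d).hom (freeOnBasis R h), ?_⟩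
  rw [← freeOnDesc_basis, ← ModuleCat.comp_apply, ← NatTrans.comp_app, Sigma.ι_desc]

theorem exact_app {X Y M : RCModule R C} {f : X ⟶ Y} {g : Y ⟶ M} {w : f ≫ g = 0}
    (h : (ShortComplex.mk f g w).Exact) (d : C) :
    Function.Exact (f.app d).hom (g.app d).hom :=
  (ShortComplex.ShortExact.moduleCat_exact_iff_function_exact _).1
    (h.map ((evaluation C (ModuleCat R)).obj d))

theorem surjective_app {X Y : RCModule R C} (f : X ⟶ Y) [Epi f] (d : C) :
    Function.Surjective (f.app d).hom :=
  (ModuleCat.epi_iff_surjective _).1 inferInstance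

theorem injective_app {X Y : RCModule R C} (f : X ⟶ Y) [Mono f] (d : C) :
    Function.Injective (f.app d).hom :=
  (ModuleCat.mono_iff_injective _).1 inferInstance

theorem isIso_map_iff (M : RCModule R C) {d e : C} (h : d ⟶ e) :
    IsIso (M.map h) ↔ Function.Bijective (M.map h).hom :=
  ConcreteCategory.isIso_iff_bijective _

end Category

section Poset

variable {R : Type v} [CommRing R] {C : Type u} [PartialOrder C]

instance {n : ℕ} (c : Fin n → C) (d : C) : Finite (Σ i, (c i ⟶ d)) :=
  Finite.of_injective Sigma.fst fun a b h => by
    obtain ⟨i, a⟩ := a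
    obtain ⟨j, b⟩ := b
    obtain rfl : i = j := h
    rw [Subsingleton.elim a b]

theorem finitePresentation_coproduct {n : ℕ} (c : Fin n → C) (d : C) :
    Module.FinitePresentation R ((∐ fun i => freeOn R (c i) : RCModule R C).obj d) :=
  Module.FinitePresentation.of_equiv (freeFamilyEquiv c d)

theorem isDetermined_coproduct {n : ℕ} (c : Fin n → C) :
    IsDetermined (Set.range c) (∐ fun i => freeOn R (c i) : RCModule R C) := by
  constructor
  · intro d (hd : Nontrivial _)
    by_contra h
    have : IsEmpty (Σ i, (c i ⟶ d)) := ⟨fun a => h ⟨_, ⟨a.1, rfl⟩, leOfHom a.2⟩⟩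
    exact not_subsingleton _ (freeFamilyEquiv (R := R) c d).symm.toEquiv.subsingleton
  · intro d e hde hS
    rw [isIso_map_iff]
    -- Equal traces on the `c i` mean that `c i ≤ d` iff `c i ≤ e`, so the bases correspond.
    have key : Function.Bijective
        (fun a : Σ i, (c i ⟶ d) => (⟨a.1, a.2 ≫ homOfLE hde⟩ : Σ i, (c i ⟶ e))) := by
      constructor
      · rintro ⟨i, a⟩ ⟨j, b⟩ h
        obtain rfl : i = j := congrArg Sigma.fst h
        rw [Subsingleton.elim a b]
      · rintro ⟨i, a⟩
        have hi : c i ∈ Set.range c ∩ Set.Iic d := hS ▸ ⟨⟨i, rfl⟩, leOfHom a⟩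
        exact ⟨⟨i, homOfLE hi.2⟩, congrArg (Sigma.mk i) (Subsingleton.elim _ _)⟩
    have h2 := (freeFamilyEquiv (R := R) c e).bijective.comp
      ((Finsupp.domLCongr (R := R) (M := R) (Equiv.ofBijective _ key)).bijective.comp
        (freeFamilyEquiv (R := R) c d).symm.bijective)
    convert h2 using 1
    ext x
    obtain ⟨x, rfl⟩ := (freeFamilyEquiv (R := R) c d).surjective x
    simp only [Function.comp_apply, LinearEquiv.symm_apply_apply]
    rw [freeFamilyEquiv_map, Finsupp.domLCongr_apply, Finsupp.domCongr_apply,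
      Finsupp.equivMapDomain_eq_mapDomain]
    rfl

theorem IsDetermined.mono {S T : Set C} (hST : S ⊆ T) {M : RCModule R C}
    (h : IsDetermined S M) : IsDetermined T M := by
  refine ⟨fun c hc => ?_, fun c d hcd hT => h.2 c d hcd ?_⟩
  · obtain ⟨s, hs, hsc⟩ := h.1 hc
    exact ⟨s, hST hs, hsc⟩
  · rw [← Set.inter_eq_left.2 hST, Set.inter_assoc, hT, Set.inter_assoc]

/-- A four-lemma chase on the right exact rows at `c` and `d`. -/
theorem IsDetermined.of_exact {S : Set C} {X Y M : RCModule R C} (hX : IsDetermined S X)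
    (hY : IsDetermined S Y) {f : X ⟶ Y} {g : Y ⟶ M} {w : f ≫ g = 0}
    (hfg : (ShortComplex.mk f g w).Exact) [Epi g] : IsDetermined S M := by
  constructor
  · intro c (hc : Nontrivial _)
    exact hY.1 (surjective_app g c).nontrivial
  · intro c d hcd hS
    have bX := (isIso_map_iff X _).1 (hX.2 c d hcd hS)
    have bY := (isIso_map_iff Y _).1 (hY.2 c d hcd hS)
    rw [isIso_map_iff]
    constructor
    · rw [injective_iff_map_eq_zero]
      intro m hm
      obtain ⟨y, rfl⟩ := surjective_app g c m
      rw [naturality_hom] at hm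
      obtain ⟨x, hx⟩ := (exact_app hfg d _).1 hm
      obtain ⟨x, rfl⟩ := bX.2 x
      rw [← naturality_hom] at hx
      exact (exact_app hfg c _).2 ⟨x, bY.1 hx⟩
    · intro m
      obtain ⟨y, rfl⟩ := surjective_app g d m
      obtain ⟨y, rfl⟩ := bY.2 y
      exact ⟨(g.app c).hom y, naturality_hom _ _ _⟩

theorem IsDetermined.kernel {S : Set C} {Y M : RCModule R C} (hY : IsDetermined S Y)
    (hM : IsDetermined S M) (g : Y ⟶ M) : IsDetermined S (kernel g) := by
  have ex := fun c => exact_app (ShortComplex.exact_kernel g) c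
  have inj := injective_app (kernel.ι g)
  constructor
  · intro c (hc : Nontrivial _)
    exact hY.1 (inj c).nontrivial
  · intro c d hcd hS
    have bM := (isIso_map_iff M _).1 (hM.2 c d hcd hS)
    have bY := (isIso_map_iff Y _).1 (hY.2 c d hcd hS)
    rw [isIso_map_iff]
    constructor
    · intro x y hxy
      apply inj c
      apply bY.1
      rw [naturality_hom, naturality_hom, hxy]
    · intro k
      obtain ⟨y, hy⟩ := bY.2 (((kernel.ι g).app d).hom k)
      -- Injectivity of `M(c) → M(d)` forces the lift `y` into the kernel.
      have hgy : (g.app c).hom y = 0 := by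
        apply bM.1
        rw [naturality_hom, hy, map_zero]
        exact (ex d _).2 ⟨k, rfl⟩
      obtain ⟨x, rfl⟩ := (ex c y).1 hgy
      rw [naturality_hom] at hy
      exact ⟨x, inj d hy⟩

/-- Here finite presentation of `M(c)` is essential: finite generation would not control the kernel.
-/
theorem finite_kernel_obj {Y M : RCModule R C} (g : Y ⟶ M) [Epi g] (c : C)
    [Module.Finite R (Y.obj c)] [Module.FinitePresentation R (M.obj c)] :
    Module.Finite R ((kernel g).obj c) := by
  have hfg := Module.FinitePresentation.fg_ker (g.app c).hom (surjective_app g c)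
  rw [LinearMap.exact_iff.1 (exact_app (ShortComplex.exact_kernel g) c)] at hfg
  have : Module.Finite R (LinearMap.range ((kernel.ι g).app c).hom) := Module.Finite.iff_fg.2 hfg
  exact Module.Finite.equiv (LinearEquiv.ofInjective _ (injective_app (kernel.ι g) c)).symm

/-- A minimal upper bound `t ≤ d` of `S ∩ Set.Iic d` has the same trace on `S` as `d`, so `M(t) →
M(d)` is an isomorphism. -/
theorem exists_finite_set_surjective (hW : WeaklyBoundedFromAbove C) (hC : MubComplete C)
    {S : Set C} (hS : S.Finite) {M : RCModule R C} (hM : IsDetermined S M) :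
    ∃ T : Set C, T.Finite ∧ ∀ d, Nontrivial (M.obj d) →
      ∃ t ∈ T, ∃ h : t ≤ d, Function.Surjective (M.map (homOfLE h)).hom := by
  refine ⟨⋃ A ∈ {A | A ⊆ S}, mub A, hS.finite_subsets.biUnion fun A hA => hW A (hS.subset hA),
    fun d hd => ?_⟩
  -- The support condition makes the trace non-empty, as mub-completeness requires.
  obtain ⟨s, hs, hsd⟩ := hM.1 hd
  obtain ⟨t, ht, htd⟩ := hC (S ∩ Set.Iic d) (hS.inter_of_left _) ⟨s, hs, hsd⟩ d fun x hx => hx.2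
  refine ⟨t, Set.mem_biUnion (show S ∩ Set.Iic d ∈ {A | A ⊆ S} from Set.inter_subset_left) ht,
    htd, ((isIso_map_iff M _).1 (hM.2 t d htd ?_)).2⟩
  exact Set.Subset.antisymm (fun x hx => ⟨hx.1, hx.2.trans htd⟩) fun x hx => ⟨hx.1, ht.1 hx⟩

theorem exists_epi_of_isDetermined (hW : WeaklyBoundedFromAbove C) (hC : MubComplete C)
    {S : Set C} (hS : S.Finite) {M : RCModule R C} (hM : IsDetermined S M)
    (hfin : ∀ c, Module.Finite R (M.obj c)) :
    ∃ (n : ℕ) (c : Fin n → C) (g : (∐ fun i => freeOn R (c i)) ⟶ M), Epi g := by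
  obtain ⟨T, hT, hsurj⟩ := exists_finite_set_surjective hW hC hS hM
  have := hT.to_subtype
  choose k x hx using fun t => (Module.Finite.exists_fin (R := R) (M := M.obj t))
  obtain ⟨n, ⟨e⟩⟩ := Finite.exists_equiv_fin (Σ t : T, Fin (k t))
  obtain ⟨g, hg⟩ := exists_hom_of_elements (M := M) (fun i => ((e.symm i).1 : C))
    (fun i => x _ (e.symm i).2)
  refine ⟨n, _, g, ?_⟩
  rw [NatTrans.epi_iff_epi_app]
  intro d
  rw [ModuleCat.epi_iff_surjective]
  -- Outside the support there may be no such `t`, but nothing has to be hit.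
  rcases subsingleton_or_nontrivial (M.obj d) with h | h
  · exact fun y => ⟨0, Subsingleton.elim _ _⟩
  obtain ⟨t, ht, htd, hs⟩ := hsurj d h
  refine LinearMap.range_eq_top.1 (top_le_iff.1 ?_)
  rw [← LinearMap.range_eq_top.2 hs, LinearMap.range_eq_map, ← hx t, Submodule.map_span_le]
  rintro _ ⟨j, rfl⟩
  have := hg (e ⟨⟨t, ht⟩, j⟩) d
  rw [e.symm_apply_apply] at this
  exact this _

theorem IsFinitelyPresented.finitePresentation_obj {M : RCModule R C}
    (h : IsFinitelyPresented M) (x : C) : Module.FinitePresentation R (M.obj x) := by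
  obtain ⟨m, n, d, c, f, g, w, hfg, hg⟩ := h
  have := finitePresentation_coproduct (R := R) c x
  have := finitePresentation_coproduct (R := R) d x
  refine Module.finitePresentation_of_surjective (g.app x).hom (surjective_app g x) ?_
  rw [LinearMap.exact_iff.1 (exact_app hfg x)]
  exact Module.Finite.iff_fg.1 inferInstance

theorem IsFinitelyPresented.exists_isDetermined {M : RCModule R C}
    (h : IsFinitelyPresented M) : ∃ S : Set C, S.Finite ∧ IsDetermined S M := by
  obtain ⟨m, n, d, c, f, g, w, hfg, hg⟩ := h
  exact ⟨Set.range d ∪ Set.range c, (Set.finite_range d).union (Set.finite_range c),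
    ((isDetermined_coproduct d).mono Set.subset_union_left).of_exact
      ((isDetermined_coproduct c).mono Set.subset_union_right) hfg⟩

theorem IsDetermined.isFinitelyPresented (hW : WeaklyBoundedFromAbove C) (hC : MubComplete C)
    {S : Set C} (hS : S.Finite) {M : RCModule R C} (hM : IsDetermined S M)
    (hfp : ∀ c, Module.FinitePresentation R (M.obj c)) : IsFinitelyPresented M := by
  obtain ⟨n, c, g, hg⟩ := exists_epi_of_isDetermined hW hC hS hM fun c => inferInstance
  -- `S` is enlarged by the `c i` so that one finite set determines both the free module and `M`.
  have hK := ((isDetermined_coproduct c).mono Set.subset_union_right).kernel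
    (hM.mono Set.subset_union_left) g
  obtain ⟨m, d, f, hf⟩ := exists_epi_of_isDetermined hW hC (hS.union (Set.finite_range c)) hK
    fun x => by
      have := finitePresentation_coproduct (R := R) c x
      exact finite_kernel_obj g x
  have w : (f ≫ kernel.ι g) ≫ g = 0 := by simp
  refine ⟨m, n, d, c, f ≫ kernel.ι g, g, w, ?_, hg⟩
  rw [ShortComplex.exact_iff_epi_kernel_lift]
  have : kernel.lift g (f ≫ kernel.ι g) w = f := by
    rw [← cancel_mono (kernel.ι g), kernel.lift_ι]
  exact this.symm ▸ hf

end Poset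

end RCMod

end

theorem mainTheorem1 {R : Type v} [CommRing R] {C : Type u} [PartialOrder C]
    (M : RCMod.RCModule R C) :
    (RCMod.IsFinitelyPresented M →
      (∀ c : C, Module.FinitePresentation R (M.obj c)) ∧
        ∃ S : Set C, S.Finite ∧ RCMod.IsDetermined S M) ∧
    (RCMod.WeaklyBoundedFromAbove C → RCMod.MubComplete C →
      (∀ c : C, Module.FinitePresentation R (M.obj c)) →
      (∃ S : Set C, S.Finite ∧ RCMod.IsDetermined S M) →
        RCMod.IsFinitelyPresented M) :=
  ⟨fun h => ⟨h.finitePresentation_obj, h.exists_isDetermined⟩,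
    fun hW hC hfp ⟨_, hS, hM⟩ => hM.isFinitelyPresented hW hC hS hfp⟩
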